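/- For a finite simple graph $F$ with at least one edge, let $\mathrm{ex}(n,F)$ be the maximum number of edges in a simple graph of order $n$ that does not contain $F$ as a (not necessarily induced) subgraph, and let the regular Turán number $\mathrm{rex}(n,F)$ be the maximum number of edges in a regular simple graph of order $n$ that does not contain $F$ as a subgraph. Let $K_4-e$ denote the complete graph $K_4$ with one edge deleted. A unicyclic graph is a connected graph with exactly one cycle. Theorem 2. Let $F$ be a finite graph with chromatic number $3$. (i) For even $n$, as $n\to\infty$, $\mathrm{rex}(n,F) = (1-o(1))\,\mathrm{ex}(n,F) = n^2/4 + o(n^2)$. Moreover, $\mathrm{rex}(n,K_3) = \mathrm{rex}(n,K_4-e) = n^2/4$ for every even $n\ge 0$. (ii) If $F=K_3$, or $F=K_4-e$, or $F$ is a unicyclic graph whose cycle is $C_3$, then for odd $n$ we have $\mathrm{rex}(n,F) = n^2/5 - O(n)$; that is, there is a constant $C$, depending only on $F$, such that $\mathrm{rex}(n,F) \ge n^2/5 - Cn$ for every odd $n$, and $\mathrm{rex}(n,F)\le n^2/5$ for every sufficiently large odd $n$. (iii) If $n=5k+s$ is odd, with integers $k\ge 0$ and $0\le s\le 4$, then $\mathrm{rex}(n,K_3)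 = kn = n\cdot\lfloor n/5\rfloor$. -/

import Mathlib

open Filter Asymptotics Finset

namespace RegTuran

/-- `G` is a regular graph: all its vertices have the same degree. -/
def IsRegular {V : Type*} (G : SimpleGraph V) [G.LocallyFinite] : Prop :=
  ∃ d : ℕ, G.IsRegularOfDegree d

open Classical in
/-- The regular Turán number `rex n F`: the maximum number of edges in a regular graph of order `n`
that does not contain `F` as a (not necessarily induced) subgraph. If `F` has an edge, the
edgeless graph is such a graph, so the maximum is taken over a nonempty set. -/
noncomputable def rex (n : ℕ) {W : Type*} (F : SimpleGraph W) : ℕ :=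
  sup {G : SimpleGraph (Fin n) | F.Free G ∧ IsRegular G} (fun G ↦ #G.edgeFinset)

/-- The triangle `K₃`. -/
abbrev K3 : SimpleGraph (Fin 3) := ⊤

/-- `K₄ - e`: the complete graph on four vertices with one edge deleted. -/
abbrev K4e : SimpleGraph (Fin 4) := (⊤ : SimpleGraph (Fin 4)).deleteEdges {s(0, 1)}

/-- `G` is a unicyclic graph (connected, with exactly one cycle as a subgraph),
and its unique cycle has length `g`. -/
def IsUnicyclicWithCycle {V : Type*} (G : SimpleGraph V) (g : ℕ) : Prop :=
  G.Connected ∧ ∃ (u : V) (c : G.Walk u u), c.IsCycle ∧ c.length = g ∧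
    ∀ (v : V) (c' : G.Walk v v), c'.IsCycle → c'.toSubgraph = c.toSubgraph

end RegTuran

namespace RegTuran

open SimpleGraph

/-! For even `n` the balanced complete bipartite graph is regular and contains no `F` that is not
2-colourable, while the minimum-degree Erdős–Stone theorem bounds the Turán number by `n²/4 +
o(n²)`; for `K₃` and `K₄ - e` a neighbourhood count makes the bound exact.

For odd `n` a regular graph of positive degree cannot be bipartite, so by Andrásfai–Erdős–Sós degree
above `2n/5` forces a triangle (`K3_isContained_of_odd`). At such a degree a triangle extends to
each special `F` once `n` is large. Hence the degree, which is even, is at most `2⌊n/5⌋`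
(`rex_le_mul_div_five`).

The matching lower bound is a triangle-free `2⌊n/5⌋`-regular graph, obtained from an unbalanced
blow-up of the pentagon by deleting edges to equalise the degrees (`mul_le_rex_K3`). It serves every
special `F`, since each contains a triangle. -/

/-! ### Bounding `rex` through degrees. -/

theorem two_mul_card_edgeFinset_of_isRegularOfDegree {V : Type*} [Fintype V] {G : SimpleGraph V}
    [DecidableRel G.Adj] {d : ℕ} (h : G.IsRegularOfDegree d) :
    2 * #G.edgeFinset = Fintype.card V * d := by
  rw [← G.sum_degrees_eq_twice_card_edges, sum_congr rfl fun v _ ↦ h v]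
  simp

open Classical in
theorem rex_le {n m : ℕ} {W : Type*} {F : SimpleGraph W}
    (h : ∀ (G : SimpleGraph (Fin n)) (d : ℕ), F.Free G → G.IsRegularOfDegree d →
      n * d ≤ 2 * m) : rex n F ≤ m := by
  refine Finset.sup_le fun G hG ↦ ?_
  simp only [mem_filter, mem_univ, true_and] at hG
  obtain ⟨hF, d, hd⟩ := hG
  have h1 := h G d hF hd
  have h2 := two_mul_card_edgeFinset_of_isRegularOfDegree hd
  rw [Fintype.card_fin] at h2
  omega

open Classical in
theorem card_edgeFinset_le_rex {n : ℕ} {W : Type*} {F : SimpleGraph W} {G : SimpleGraph (Fin n)}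
    {d : ℕ} (hF : F.Free G) (hd : G.IsRegularOfDegree d) : #G.edgeFinset ≤ rex n F :=
  Finset.le_sup (f := fun G : SimpleGraph (Fin n) ↦ #G.edgeFinset)
    (mem_filter.2 ⟨mem_univ _, hF, d, hd⟩)

open Classical in
theorem le_rex {V : Type*} [Fintype V] {n m d : ℕ} {W : Type*} {F : SimpleGraph W}
    (hV : Fintype.card V = n) (G : SimpleGraph V) (hF : F.Free G) (hd : G.IsRegularOfDegree d)
    (hm : 2 * m = n * d) : m ≤ rex n F := by
  let e := G.overFinIso hV
  have hd' : (G.overFin hV).IsRegularOfDegree d := fun v ↦ by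
    rw [← hd (e.symm v), ← e.degree_eq, e.apply_symm_apply]
  have h1 := card_edgeFinset_le_rex (F := F) (fun h ↦ hF (h.trans e.isContained')) hd'
  have h2 := two_mul_card_edgeFinset_of_isRegularOfDegree hd'
  rw [Fintype.card_fin] at h2
  omega

theorem rex_mono {n : ℕ} {W W' : Type*} {F : SimpleGraph W} {F' : SimpleGraph W'} (h : F ⊑ F') :
    rex n F ≤ rex n F' := by
  classical
  refine Finset.sup_mono fun G hG ↦ ?_
  simp only [mem_filter, mem_univ, true_and] at hG ⊢
  exact ⟨fun h' ↦ hG.1 (h.trans h'), hG.2⟩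

open Classical in
theorem rex_le_extremalNumber (n : ℕ) {W : Type*} (F : SimpleGraph W) :
    rex n F ≤ extremalNumber n F := by
  refine Finset.sup_le fun G hG ↦ ?_
  simp only [mem_filter, mem_univ, true_and] at hG
  simpa using card_edgeFinset_le_extremalNumber hG.1

theorem mul_self_le_rex {W : Type*} {F : SimpleGraph W} (hF : ¬ F.Colorable 2) (m : ℕ) :
    m * m ≤ rex (m + m) F := by
  classical
  refine le_rex (V := Fin m ⊕ Fin m) (d := m) (by simp) (completeBipartiteGraph (Fin m) (Fin m))
    ?_ ?_ (by ring)
  · rintro ⟨f⟩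
    exact hF ((Coloring.colorable
      ((CompleteBipartiteGraph.bicoloring (Fin m) (Fin m)).comp f.toHom)).mono (by simp))
  · rintro (v | v)
    · rw [← card_neighborFinset_eq_degree]
      have : (completeBipartiteGraph (Fin m) (Fin m)).neighborFinset (.inl v) =
        univ.map .inr := by ext (w | w) <;> simp
      rw [this]; simp
    · rw [← card_neighborFinset_eq_degree]
      have : (completeBipartiteGraph (Fin m) (Fin m)).neighborFinset (.inr v) =
        univ.map .inl := by ext (w | w) <;> simp
      rw [this]; simp

/-! ### Triangles and `K₄ - e`; exact values for even order. -/

theorem K3_isContained_iff {V : Type*} {G : SimpleGraph V} :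
    K3 ⊑ G ↔ ∃ a b c, G.Adj a b ∧ G.Adj a c ∧ G.Adj b c := by
  constructor
  · rintro ⟨f⟩
    exact ⟨f 0, f 1, f 2, f.toHom.map_adj (by decide), f.toHom.map_adj (by decide),
      f.toHom.map_adj (by decide)⟩
  · rintro ⟨a, b, c, hab, hac, hbc⟩
    refine ⟨⟨⟨![a, b, c], ?_⟩, ?_⟩⟩
    · intro i j hij
      fin_cases i <;> fin_cases j <;> simp_all [G.adj_comm]
    · intro i j hij
      have := hab.ne; have := hac.ne; have := hbc.ne
      fin_cases i <;> fin_cases j <;> simp_all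

theorem K3_free_iff {V : Type*} {G : SimpleGraph V} : K3.Free G ↔ G.CliqueFree 3 := by
  classical
  rw [SimpleGraph.Free, K3_isContained_iff, CliqueFree]
  constructor
  · intro h s hs
    obtain ⟨a, b, c, h1, h2, h3, -⟩ := is3Clique_iff.1 hs
    exact h ⟨a, b, c, h1, h2, h3⟩
  · rintro h ⟨a, b, c, h1, h2, h3⟩
    exact h {a, b, c} (is3Clique_iff.2 ⟨a, b, c, h1, h2, h3, rfl⟩)

theorem K4e_isContained {V : Type*} {G : SimpleGraph V} {a b c d : V} (hab : a ≠ b)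
    (hcd : G.Adj c d) (hac : G.Adj a c) (had : G.Adj a d) (hbc : G.Adj b c) (hbd : G.Adj b d) :
    K4e ⊑ G := by
  refine ⟨⟨⟨![a, b, c, d], ?_⟩, ?_⟩⟩
  · intro i j hij
    rw [deleteEdges_adj] at hij
    fin_cases i <;> fin_cases j <;> simp_all [G.adj_comm]
  · intro i j hij
    have := hcd.ne; have := hac.ne; have := had.ne; have := hbc.ne; have := hbd.ne
    fin_cases i <;> fin_cases j <;> simp_all

theorem K3_isContained_K4e : K3 ⊑ K4e :=
  K3_isContained_iff.2 ⟨1, 2, 3, by decide, by decide, by decide⟩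

theorem not_colorable_two_of_K3_isContained {W : Type*} {F : SimpleGraph W} (h : K3 ⊑ F) :
    ¬ F.Colorable 2 := by
  obtain ⟨f⟩ := h
  rintro ⟨C⟩
  have := Fintype.card_le_of_injective _ (C.comp f.toHom).injective_of_top_hom
  simp at this

/-- In a `K₄ - e`-free graph the end vertices of an edge have at most one common neighbour. -/
theorem card_inter_neighborFinset_le_one {V : Type*} [Fintype V] [DecidableEq V]
    {G : SimpleGraph V} [DecidableRel G.Adj] (h : K4e.Free G) {c d : V} (hcd : G.Adj c d) :
    #(G.neighborFinset c ∩ G.neighborFinset d) ≤ 1 := by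
  by_contra! hlt
  obtain ⟨a, ha, b, hb, hab⟩ := one_lt_card.1 hlt
  simp only [mem_inter, mem_neighborFinset] at ha hb
  exact h (K4e_isContained hab hcd ha.1.symm ha.2.symm hb.1.symm hb.2.symm)

/-- The neighbourhoods of two adjacent vertices overlap in at most one vertex, so their union has at
least `2d - 1` elements. -/
theorem two_mul_le_card_add_one {V : Type*} [Fintype V] [DecidableEq V] {G : SimpleGraph V}
    [DecidableRel G.Adj] (h : K4e.Free G) {d : ℕ} (hd : G.IsRegularOfDegree d) (hd0 : 0 < d) (v : V) :
    2 * d ≤ Fintype.card V + 1 := by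
  obtain ⟨w, hw⟩ := (G.degree_pos_iff_exists_adj v).1 (by rwa [hd v])
  have h1 := card_inter_neighborFinset_le_one h hw
  have h2 := card_union_add_card_inter (G.neighborFinset v) (G.neighborFinset w)
  have h3 := card_le_univ (G.neighborFinset v ∪ G.neighborFinset w)
  rw [card_neighborFinset_eq_degree, card_neighborFinset_eq_degree, hd, hd] at h2
  omega

theorem rex_K4e_add_self_le (m : ℕ) : rex (m + m) K4e ≤ m * m := by
  classical
  refine rex_le fun G d hF hd ↦ ?_
  obtain rfl | hd0 := d.eq_zero_or_pos
  · simp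
  obtain rfl | hm := m.eq_zero_or_pos
  · simp
  have := two_mul_le_card_add_one hF hd hd0 ⟨0, by omega⟩
  rw [Fintype.card_fin] at this
  have hdm : d ≤ m := by omega
  nlinarith

theorem rex_add_self_eq {m : ℕ} : rex (m + m) K3 = m * m ∧ rex (m + m) K4e = m * m := by
  have h1 := mul_self_le_rex (not_colorable_two_of_K3_isContained (.refl _)) m
  have h2 := rex_mono (n := m + m) K3_isContained_K4e
  have h3 := rex_K4e_add_self_le m
  omega

/-! ### Asymptotics for even order. -/

theorem exists_isContained_completeEquipartiteGraph {W : Type*} [Finite W] {F : SimpleGraph W}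
    {r : ℕ} (hF : F.Colorable r) : ∃ t, F ⊑ completeEquipartiteGraph r t := by
  classical
  have := Fintype.ofFinite W
  obtain ⟨C⟩ := hF
  exact ⟨Fintype.card W, isContained_completeEquipartiteGraph_of_colorable C _
    fun c ↦ Fintype.card_subtype_le _⟩

/-- Deleting a vertex of minimum degree from an extremal graph, which by the minimum degree form
of the Erdős–Stone theorem is less than `(1 / 2 + ε) n`. -/
theorem eventually_extremalNumber_succ_le {W : Type*} [Finite W] {F : SimpleGraph W}
    (hF : F.Colorable 3) {ε : ℝ} (hε : 0 < ε) :
    ∀ᶠ n : ℕ in atTop, (extremalNumber (n + 1) F : ℝ) ≤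
      extremalNumber n F + (1 / 2 + ε) * (n + 1 : ℕ) := by
  classical
  obtain ⟨t, ht⟩ := exists_isContained_completeEquipartiteGraph hF
  have h := eventually_completeEquipartiteGraph_isContained_of_minDegree hε 2 t
  filter_upwards [(tendsto_add_atTop_nat 1).eventually h] with n hn
  have key := (extremalNumber_le_iff_of_nonneg (V := Fin (n + 1)) (R := ℝ) F
    (m := extremalNumber n F + (1 / 2 + ε) * (n + 1 : ℕ)) (by positivity)).2 ?_
  · simpa only [Fintype.card_fin] using key
  intro G _ hG
  have hmin : (G.minDegree : ℝ) < (1 / 2 + ε) * (n + 1 : ℕ) := by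
    by_contra! hge
    refine hG (ht.trans (hn (le_of_eq_of_le ?_ hge)))
    norm_num
  obtain ⟨v, hv⟩ := G.exists_minimal_degree_vertex
  have h1 := card_edgeFinset_deleteIncidenceSet_le_extremalNumber hG v
  rw [card_edgeFinset_deleteIncidenceSet, Fintype.card_fin, Nat.add_sub_cancel, ← hv,
    tsub_le_iff_right] at h1
  have h2 : (#G.edgeFinset : ℝ) ≤ extremalNumber n F + G.minDegree := by exact_mod_cast h1
  linarith

theorem exists_extremalNumber_le {W : Type*} [Finite W] {F : SimpleGraph W}
    (hF : F.Colorable 3) {ε : ℝ} (hε : 0 < ε) :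
    ∃ C : ℝ, ∀ᶠ n : ℕ in atTop, (extremalNumber n F : ℝ) ≤ C + (1 / 2 + ε) * (n * (n + 1) / 2) := by
  obtain ⟨N, hN⟩ := eventually_atTop.1 (eventually_extremalNumber_succ_le hF hε)
  refine ⟨extremalNumber N F, eventually_atTop.2 ⟨N, fun n hn ↦ ?_⟩⟩
  induction n, hn using Nat.le_induction with
  | base => linarith [show 0 ≤ (1 / 2 + ε) * ((N : ℝ) * (N + 1) / 2) by positivity]
  | succ n hn ih =>
    have := hN n hn
    push_cast at this ⊢
    linarith

theorem eventually_extremalNumber_le {W : Type*} [Finite W] {F : SimpleGraph W}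
    (hF : F.Colorable 3) {ε : ℝ} (hε : 0 < ε) :
    ∀ᶠ n : ℕ in atTop, (extremalNumber n F : ℝ) ≤ (n : ℝ) ^ 2 / 4 + ε * (n : ℝ) ^ 2 := by
  obtain ⟨C, hC⟩ := exists_extremalNumber_le hF hε
  -- For `n ≥ M`, both `C` and the linear term `(1/2 + ε)n/2` are at most `εn²/4`.
  obtain ⟨M, hM⟩ := exists_nat_gt (max (|C| * 4 / ε) (2 / ε + 2))
  have hM1 := (le_max_left _ _).trans_lt hM
  have hM2 := (le_max_right _ _).trans_lt hM
  rw [div_lt_iff₀ hε] at hM1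
  rw [← lt_sub_iff_add_lt, div_lt_iff₀ hε] at hM2
  filter_upwards [hC, eventually_ge_atTop M, eventually_ge_atTop 1] with n hn hnM hn1
  have hnM' : (M : ℝ) ≤ n := by exact_mod_cast hnM
  have hn1' : (1 : ℝ) ≤ n := by exact_mod_cast hn1
  have h1 : |C| * 4 < n * ε := hM1.trans_le (by gcongr)
  have h2 : 2 < (n - 2) * ε := hM2.trans_le (by gcongr)
  have h3 : n * ε ≤ n * (n * ε) := le_mul_of_one_le_left (by positivity) hn1'
  have h4 : 2 * (n : ℝ) < (n - 2) * ε * n := by gcongr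
  have h5 := le_abs_self C
  nlinarith

theorem eventually_abs_sub_le {W : Type*} [Finite W] {F : SimpleGraph W}
    (hF : F.Colorable 3) (hF' : ¬ F.Colorable 2) {ε : ℝ} (hε : 0 < ε) :
    ∀ᶠ n : ℕ in atTop ⊓ 𝓟 {n : ℕ | Even n},
      (n : ℝ) ^ 2 / 4 ≤ rex n F ∧ (rex n F : ℝ) ≤ extremalNumber n F ∧
      (extremalNumber n F : ℝ) ≤ (n : ℝ) ^ 2 / 4 + ε * (n : ℝ) ^ 2 := by
  rw [eventually_inf_principal]
  filter_upwards [eventually_extremalNumber_le hF hε] with n hn ⟨m, hm⟩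
  refine ⟨?_, by exact_mod_cast rex_le_extremalNumber n F, hn⟩
  have : ((m * m : ℕ) : ℝ) ≤ rex n F := by rw [hm]; exact_mod_cast mul_self_le_rex hF' m
  refine le_trans (le_of_eq ?_) this
  rw [hm]; push_cast; ring

theorem rex_sub_isLittleO {W : Type*} [Finite W] {F : SimpleGraph W}
    (hF : F.Colorable 3) (hF' : ¬ F.Colorable 2) :
    (fun n : ℕ ↦ (rex n F : ℝ) - (n : ℝ) ^ 2 / 4)
        =o[atTop ⊓ 𝓟 {n : ℕ | Even n}] (fun n : ℕ ↦ (n : ℝ) ^ 2) := by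
  refine isLittleO_iff.2 fun ε hε ↦ ?_
  filter_upwards [eventually_abs_sub_le hF hF' hε] with n ⟨h1, h2, h3⟩
  rw [Real.norm_of_nonneg (by linarith), Real.norm_of_nonneg (by positivity)]
  linarith

theorem rex_isEquivalent_extremalNumber {W : Type*} [Finite W] {F : SimpleGraph W}
    (hF : F.Colorable 3) (hF' : ¬ F.Colorable 2) :
    (fun n : ℕ ↦ (rex n F : ℝ)) ~[atTop ⊓ 𝓟 {n : ℕ | Even n}]
      (fun n : ℕ ↦ (extremalNumber n F : ℝ)) := by
  refine isLittleO_iff.2 fun ε hε ↦ ?_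
  -- As `ex(n, F) ≥ n²/4`, an error of `(ε/4)n²` is at most `ε · ex(n, F)`.
  filter_upwards [eventually_abs_sub_le hF hF' (show 0 < ε / 4 by positivity)] with n ⟨h1, h2, h3⟩
  rw [Pi.sub_apply, norm_sub_rev, Real.norm_of_nonneg (by linarith),
    Real.norm_of_nonneg (by positivity)]
  nlinarith

/-! ### Upper bound for odd order. -/

/-- Counting edges from either side shows that the two classes have equal size. -/
theorem even_of_isBipartite_of_isRegularOfDegree {V : Type*} [Fintype V] {G : SimpleGraph V}
    [DecidableRel G.Adj] {d : ℕ} (hG : G.IsBipartite) (hd : G.IsRegularOfDegree d) (hd0 : 0 < d) :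
    Even (Fintype.card V) := by
  classical
  obtain ⟨C⟩ := hG
  have hB : G.IsBipartiteWith ((univ.filter (C · = 0) : Finset V) : Set V)
      ((univ.filter (¬ C · = 0) : Finset V) : Set V) := by
    refine ⟨disjoint_coe.2 (disjoint_filter_filter_not _ _ (C · = 0)), fun v w hvw ↦ ?_⟩
    have := C.valid hvw
    simp only [mem_coe, mem_filter, mem_univ, true_and]
    omega
  have h := isBipartiteWith_sum_degrees_eq hB
  rw [sum_congr rfl fun v _ ↦ hd v, sum_congr rfl fun v _ ↦ hd v] at h
  simp only [sum_const, smul_eq_mul] at h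
  have h' := Nat.eq_of_mul_eq_mul_right hd0 h
  have := card_filter_add_card_filter_not (s := (univ : Finset V)) (C · = 0)
  rw [card_univ] at this
  exact ⟨_, by rw [← this, ← h']⟩

/-- By the Andrásfai–Erdős–Sós theorem, a triangle-free graph with minimum degree above `2n / 5` is
bipartite, and a bipartite regular graph has even order. -/
theorem K3_isContained_of_odd {n : ℕ} (hn : Odd n) {G : SimpleGraph (Fin n)}
    [DecidableRel G.Adj] {d : ℕ} (hd : G.IsRegularOfDegree d) (h : 2 * n < 5 * d) : K3 ⊑ G := by
  by_contra hF
  have : Nonempty (Fin n) := ⟨⟨0, hn.pos⟩⟩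
  have hmin : G.minDegree = d := by
    obtain ⟨v, hv⟩ := G.exists_minimal_degree_vertex
    rw [hv, hd v]
  have hG : G.Colorable 2 := by
    refine colorable_of_cliqueFree_lt_minDegree (K3_free_iff.1 hF) ?_
    rw [hmin, Fintype.card_fin]
    omega
  have := even_of_isBipartite_of_isRegularOfDegree hG hd (by omega)
  rw [Fintype.card_fin] at this
  exact Nat.not_even_iff_odd.2 hn this

open Classical in
theorem rex_le_mul_div_five {n : ℕ} (hn : Odd n) {W : Type*} {F : SimpleGraph W}
    (h : ∀ (G : SimpleGraph (Fin n)) (d : ℕ), G.IsRegularOfDegree d → 2 * n < 5 * d → K3 ⊑ G →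
      F ⊑ G) : rex n F ≤ n * (n / 5) := by
  refine rex_le fun G d hF hd ↦ ?_
  have h1 : 5 * d ≤ 2 * n := by
    by_contra! hlt
    exact hF (h G d hd hlt (K3_isContained_of_odd hn hd hlt))
  have h2 := two_mul_card_edgeFinset_of_isRegularOfDegree hd
  rw [Fintype.card_fin] at h2
  -- Parity of `d` turns `5d ≤ 2n` into `d/2 ≤ ⌊n/5⌋`, which gives the exact floor.
  obtain ⟨e, rfl⟩ : Even d := by
    have : Even (n * d) := ⟨_, h2.symm.trans (two_mul _)⟩
    exact (Nat.even_mul.1 this).resolve_left (Nat.not_even_iff_odd.2 hn)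
  have h3 : e ≤ n / 5 := by omega
  calc n * (e + e) = 2 * (n * e) := by ring
    _ ≤ _ := by gcongr

/-- Otherwise the neighbourhoods of the triangle's vertices meet pairwise in at most one vertex, so
their union has at least `3d - 3` elements. -/
theorem K4e_isContained_of_K3_isContained {V : Type*} [Fintype V] {G : SimpleGraph V}
    [DecidableRel G.Adj] {d : ℕ} (hd : G.IsRegularOfDegree d)
    (hlt : Fintype.card V + 3 < 3 * d) (h : K3 ⊑ G) : K4e ⊑ G := by
  classical
  by_contra hF
  obtain ⟨a, b, c, hab, hac, hbc⟩ := K3_isContained_iff.1 h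
  have h1 := card_inter_neighborFinset_le_one hF hab
  have h2 := card_inter_neighborFinset_le_one hF hac
  have h3 := card_inter_neighborFinset_le_one hF hbc
  have h4 := card_union_add_card_inter (G.neighborFinset a) (G.neighborFinset b)
  have h5 := card_union_add_card_inter (G.neighborFinset a ∪ G.neighborFinset b)
    (G.neighborFinset c)
  have h6 := card_le_univ (G.neighborFinset a ∪ G.neighborFinset b ∪ G.neighborFinset c)
  rw [union_inter_distrib_right] at h5
  have h7 := card_union_le (G.neighborFinset a ∩ G.neighborFinset c)
    (G.neighborFinset b ∩ G.neighborFinset c)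
  simp only [card_neighborFinset_eq_degree, hd a, hd b, hd c] at h4 h5
  omega

/-! ### Embedding unicyclic graphs. -/

/-- In a graph all of whose cycles lie inside `T`, a vertex outside a connected set `S ⊇ T` has at
most one neighbour in `S`. -/
theorem eq_of_adj_of_adj_of_cycles_subset {W : Type*} {F : SimpleGraph W} {T S : Finset W}
    (hT : ∀ (v : W) (c : F.Walk v v), c.IsCycle → v ∈ T) (hTS : T ⊆ S) {r : W}
    (hS : ∀ x ∈ S, ∃ p : F.Walk r x, ∀ z ∈ p.support, z ∈ S) {v s s' : W} (hv : v ∉ S)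
    (hs : s ∈ S) (hs' : s' ∈ S) (h : F.Adj v s) (h' : F.Adj v s') : s = s' := by
  classical
  by_contra hne
  obtain ⟨p, hp⟩ := hS s hs
  obtain ⟨q, hq⟩ := hS s' hs'
  have hpq : ∀ z ∈ (p.reverse.append q).bypass.support, z ∈ S := fun z hz ↦ by
    have := Walk.support_bypass_subset_support _ hz
    rw [Walk.mem_support_append_iff, Walk.support_reverse, List.mem_reverse] at this
    exact this.elim (hp z) (hq z)
  -- A path from `s` to `s'` inside `S`, closed up through `v`, is a cycle containing `v ∉ T`.
  refine hv (hTS (hT v (Walk.cons h ((p.reverse.append q).bypass.concat h'.symm)) ?_))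
  rw [Walk.cons_isCycle_iff]
  refine ⟨((p.reverse.append q).bypass_isPath).concat (fun hz ↦ hv (hpq v hz)) _, ?_⟩
  rw [Walk.edges_concat, List.concat_eq_append, List.mem_append]
  rintro (hm | hm)
  · exact hv (hpq v (Walk.fst_mem_support_of_mem_edges _ hm))
  · simp only [List.mem_singleton, Sym2.eq_iff] at hm
    obtain ⟨h1, h2⟩ | ⟨-, h2⟩ := hm
    · exact h'.ne h1
    · exact hne h2

/-- Greedy embedding: attach the remaining vertices one at a time to a copy of the part of `F` that
contains all of its cycles. -/
theorem isContained_of_cycles_subset {W V : Type*} [Fintype W] [Fintype V] {F : SimpleGraph W}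
    {G : SimpleGraph V} [DecidableRel G.Adj] (hF : F.Connected) {T : Finset W}
    (hT : ∀ (v : W) (c : F.Walk v v), c.IsCycle → v ∈ T) {r : W} (hr : r ∈ T)
    (hTr : ∀ x ∈ T, ∃ p : F.Walk r x, ∀ z ∈ p.support, z ∈ T) (f : W → V)
    (hf : Set.InjOn f T) (hfT : ∀ x ∈ T, ∀ y ∈ T, F.Adj x y → G.Adj (f x) (f y))
    (hd : ∀ v, Fintype.card W ≤ G.degree v) : F ⊑ G := by
  classical
  let P : Finset W → Prop := fun S ↦ T ⊆ S ∧ (∀ x ∈ S, ∃ p : F.Walk r x, ∀ z ∈ p.support, z ∈ S) ∧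
    ∃ f : W → V, Set.InjOn f S ∧ ∀ x ∈ S, ∀ y ∈ S, F.Adj x y → G.Adj (f x) (f y)
  obtain ⟨S, ⟨hTS, hS, g, hg, hgS⟩, hmax⟩ := (Set.toFinite {S | P S}).exists_maximal
    ⟨T, subset_rfl, hTr, f, hf, hfT⟩
  suffices hSu : S = univ by
    subst hSu
    refine ⟨⟨⟨g, fun {x y} hxy ↦ hgS x (mem_univ _) y (mem_univ _) hxy⟩, fun x y hxy ↦ ?_⟩⟩
    exact hg (mem_coe.2 (mem_univ x)) (mem_coe.2 (mem_univ y)) hxy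
  by_contra hSu
  obtain ⟨w, hw⟩ : ∃ w, w ∉ S := by simpa [eq_univ_iff_forall] using hSu
  obtain ⟨p⟩ := hF.preconnected r w
  obtain ⟨e, -, hs, hv⟩ := p.exists_boundary_dart (S : Set W) (hTS hr) hw
  obtain ⟨⟨s, v⟩, hsv⟩ := e
  simp only [mem_coe] at hs hv hsv
  -- Fewer than `|W|` vertices are occupied, so the degree bound leaves a free neighbour of `g s`
  -- for `v`.
  obtain ⟨a, ha, haS⟩ : ∃ a ∈ G.neighborFinset (g s), a ∉ S.image g := by
    refine exists_mem_notMem_of_card_lt_card (card_image_le.trans_lt ?_)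
    rw [card_neighborFinset_eq_degree]
    exact ((card_lt_univ_of_notMem hw)).trans_le (hd _)
  rw [mem_neighborFinset] at ha
  have hgv : ∀ x ∈ S, Function.update g v a x = g x := fun x hx ↦
    Function.update_of_ne (ne_of_mem_of_not_mem hx hv) _ _
  have hadj : ∀ x ∈ S, F.Adj v x → x = s := fun x hx hvx ↦
    eq_of_adj_of_adj_of_cycles_subset hT hTS hS hv hx hs hvx hsv.symm
  refine hv (hmax (y := insert v S) ⟨hTS.trans (subset_insert _ _), ?_, Function.update g v a,
    ?_, ?_⟩ (subset_insert _ _) (mem_insert_self _ _))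
  · intro x hx
    obtain rfl | hx := mem_insert.1 hx
    · obtain ⟨q, hq⟩ := hS s hs
      refine ⟨q.concat hsv, fun z hz ↦ ?_⟩
      rw [Walk.support_concat, List.mem_append, List.mem_singleton] at hz
      exact mem_insert.2 (hz.symm.imp_right (hq z))
    · obtain ⟨q, hq⟩ := hS x hx
      exact ⟨q, fun z hz ↦ mem_insert_of_mem (hq z hz)⟩
  · rw [coe_insert, Set.injOn_insert (by simpa using hv)]
    refine ⟨hg.congr fun x hx ↦ (hgv x hx).symm, ?_⟩
    rintro ⟨x, hx, hxa⟩
    rw [hgv x hx, Function.update_self] at hxa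
    exact haS (mem_image.2 ⟨x, hx, hxa⟩)
  · intro x hx y hy hxy
    obtain rfl | hx' := mem_insert.1 hx <;> obtain rfl | hy' := mem_insert.1 hy
    · exact absurd hxy (F.loopless.irrefl _)
    · rw [hgv y hy', Function.update_self, hadj y hy' hxy]
      exact ha.symm
    · rw [hgv x hx', Function.update_self, hadj x hx' hxy.symm]
      exact ha
    · rw [hgv x hx', hgv y hy']
      exact hgS x hx' y hy' hxy

theorem IsUnicyclicWithCycle.isContained {W V : Type*} [Fintype W] [Fintype V]
    {F : SimpleGraph W} {G : SimpleGraph V} [DecidableRel G.Adj] (hF : IsUnicyclicWithCycle F 3)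
    (hd : ∀ v, Fintype.card W ≤ G.degree v) (hG : K3 ⊑ G) : F ⊑ G := by
  classical
  obtain ⟨hconn, u, c, -, hlen, huniq⟩ := hF
  obtain ⟨x, y, z, hxy, hxz, hyz⟩ := K3_isContained_iff.1 hG
  match c, hlen with
  | .cons (v := v) h1 (.cons (v := w) h2 (.cons h3 .nil)), _ =>
    have hT : ∀ (a : W) (c : F.Walk a a), c.IsCycle → a ∈ ({u, v, w} : Finset W) := by
      intro a c' hc'
      have : a ∈ c'.toSubgraph.verts := c'.mem_verts_toSubgraph.2 c'.start_mem_support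
      rw [huniq a c' hc', Walk.mem_verts_toSubgraph] at this
      simp only [Walk.support_cons, Walk.support_nil, List.mem_cons, List.not_mem_nil] at this
      simp only [mem_insert, mem_singleton]
      tauto
    have := h1.ne; have := h1.ne'; have := h2.ne; have := h2.ne'; have := h3.ne; have := h3.ne'
    refine isContained_of_cycles_subset hconn hT (r := u) (by simp) ?_
      (fun a ↦ if a = u then x else if a = v then y else z) ?_ ?_ hd
    · simp only [mem_insert, mem_singleton, forall_eq_or_imp, forall_eq]
      refine ⟨⟨.nil, by simp⟩, ⟨.cons h1 .nil, by simp⟩, ⟨.cons h3.symm .nil, by simp⟩⟩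
    · have := hxy.ne; have := hxz.ne; have := hyz.ne
      intro a ha b hb hab
      simp only [coe_insert, coe_singleton, Set.mem_insert_iff, Set.mem_singleton_iff] at ha hb
      obtain rfl | rfl | rfl := ha <;> obtain rfl | rfl | rfl := hb <;> simp_all
    · simp only [mem_insert, mem_singleton]
      rintro a (rfl | rfl | rfl) b (rfl | rfl | rfl) hab <;> simp_all [G.adj_comm]

theorem IsUnicyclicWithCycle.K3_isContained {W : Type*} {F : SimpleGraph W}
    (hF : IsUnicyclicWithCycle F 3) : K3 ⊑ F := by
  obtain ⟨-, u, c, -, hlen, -⟩ := hF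
  match c, hlen with
  | .cons (v := v) h1 (.cons (v := w) h2 (.cons h3 .nil)), _ =>
    exact K3_isContained_iff.2 ⟨_, _, _, h1, h3.symm, h2⟩

theorem K3_isContained_of_special {W : Type*} {F : SimpleGraph W}
    (hF : Nonempty (F ≃g K3) ∨ Nonempty (F ≃g K4e) ∨ IsUnicyclicWithCycle F 3) : K3 ⊑ F := by
  obtain ⟨⟨e⟩⟩ | ⟨⟨e⟩⟩ | h := hF
  · exact e.isContained'
  · exact K3_isContained_K4e.trans e.isContained'
  · exact h.K3_isContained

theorem exists_rex_le_mul_div_five {W : Type*} [Finite W] {F : SimpleGraph W}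
    (hF : Nonempty (F ≃g K3) ∨ Nonempty (F ≃g K4e) ∨ IsUnicyclicWithCycle F 3) :
    ∃ N : ℕ, ∀ n, N ≤ n → Odd n → rex n F ≤ n * (n / 5) := by
  classical
  have := Fintype.ofFinite W
  obtain ⟨⟨e⟩⟩ | ⟨⟨e⟩⟩ | h := hF
  · exact ⟨0, fun n _ hn ↦ rex_le_mul_div_five hn fun G d _ _ hG ↦ e.isContained.trans hG⟩
  · refine ⟨13, fun n hN hn ↦ rex_le_mul_div_five hn fun G d hd hlt hG ↦
      e.isContained.trans (K4e_isContained_of_K3_isContained hd ?_ hG)⟩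
    rw [Fintype.card_fin]
    omega
  · refine ⟨3 * Fintype.card W, fun n hN hn ↦ rex_le_mul_div_five hn fun G d hd hlt hG ↦
      h.isContained (fun v ↦ ?_) hG⟩
    rw [hd v]
    omega

/-! ### Lower bound for odd order. -/

/-- The adjacency relation of `pentagonGraph`. -/
def pentagonAdj {A B C : Type*} (M N : B → B → Prop) :
    A ⊕ (Bool × (B ⊕ (B ⊕ C))) → A ⊕ (Bool × (B ⊕ (B ⊕ C))) → Prop
  | .inl _, .inr (_, .inl _) => True
  | .inr (_, .inl _), .inl _ => True
  | .inr (b, .inl x), .inr (b', .inr (.inl y)) => b = b' ∧ ¬ M x y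
  | .inr (b, .inr (.inl y)), .inr (b', .inl x) => b = b' ∧ ¬ M x y
  | .inr (b, .inl _), .inr (b', .inr (.inr _)) => b = b'
  | .inr (b, .inr (.inr _)), .inr (b', .inl _) => b = b'
  | .inr (b, .inr (.inl x)), .inr (b', .inr (.inl y)) => b ≠ b' ∧ ¬ (N x y ∨ N y x)
  | .inr (b, .inr (.inl _)), .inr (b', .inr (.inr _)) => b ≠ b'
  | .inr (b, .inr (.inr _)), .inr (b', .inr (.inl _)) => b ≠ b'
  | _, _ => False

/-- A subgraph of a blow-up of the pentagon. Its five classes are, in cyclic order,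
`A`, `(true, B)`, `(true, B ⊕ C)`, `(false, B ⊕ C)` and `(false, B)`. Compared with the blow-up, the
edges in `M` between the second and third (and fifth and fourth) class, the edges in `N` between the
third and fourth class, and all edges between the two copies of `C` are missing. -/
def pentagonGraph (A : Type*) {B : Type*} (C : Type*) (M N : B → B → Prop) :
    SimpleGraph (A ⊕ (Bool × (B ⊕ (B ⊕ C)))) where
  Adj := pentagonAdj M N
  symm := ⟨by
    rintro (a | ⟨b, x | x | x⟩) (a' | ⟨b', x' | x' | x'⟩) h <;>
    simp_all [pentagonAdj] <;> grind⟩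
  loopless := ⟨by rintro (a | ⟨b, x | x | x⟩) <;> simp [pentagonAdj]⟩

/-- The class map is a homomorphism to the 5-cycle, which has no triangle. -/
theorem K3_free_pentagonGraph {A B C : Type*} (M N : B → B → Prop) :
    K3.Free (pentagonGraph A C M N) := by
  let φ : A ⊕ (Bool × (B ⊕ (B ⊕ C))) → Fin 5 := fun
    | .inl _ => 0
    | .inr (true, .inl _) => 1
    | .inr (true, .inr _) => 2
    | .inr (false, .inr _) => 3
    | .inr (false, .inl _) => 4
  have hφ : ∀ v w, (pentagonGraph A C M N).Adj v w → φ v - φ w = 1 ∨ φ w - φ v = 1 := by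
    rintro (a | ⟨_ | _, x | x | x⟩) (a' | ⟨_ | _, x' | x' | x'⟩) h <;>
    simp_all [pentagonGraph, pentagonAdj, φ] <;> decide
  have h5 : ∀ i j l : Fin 5, (i - j = 1 ∨ j - i = 1) → (i - l = 1 ∨ l - i = 1) →
      (j - l = 1 ∨ l - j = 1) → False := by decide
  intro h
  obtain ⟨a, b, c, hab, hac, hbc⟩ := K3_isContained_iff.1 h
  exact h5 _ _ _ (hφ _ _ hab) (hφ _ _ hac) (hφ _ _ hbc)

open Classical in
theorem pentagonGraph_isRegularOfDegree {A B C : Type*} [Fintype A] [Fintype B] [Fintype C]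
    {M N : B → B → Prop} {u e : ℕ} (hN : ∀ x y, N x y → N y x)
    (hM₁ : ∀ x, #{y | M x y} = u) (hM₂ : ∀ y, #{x | M x y} = u) (hN₁ : ∀ x, #{y | N x y} = e)
    (hA : Fintype.card B = Fintype.card A + e) (hC : Fintype.card C = u + e) :
    (pentagonGraph A C M N).IsRegularOfDegree (2 * Fintype.card B) := by
  have hdeg : ∀ v, (pentagonGraph A C M N).degree v =
      ∑ w, if pentagonAdj M N v w then 1 else 0 := fun v ↦ by
    rw [← card_neighborFinset_eq_degree, neighborFinset_eq_filter, card_filter]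
    rfl
  have hN' : ∀ x y, (N x y ∨ N y x) ↔ N x y := fun x y ↦ ⟨fun h ↦ h.elim id (hN y x), .inl⟩
  have h₁ : ∀ x, #{y | ¬ M x y} + u = Fintype.card B := fun x ↦ by
    rw [← hM₁ x, add_comm, card_filter_add_card_filter_not, card_univ]
  have h₂ : ∀ y, #{x | ¬ M x y} + u = Fintype.card B := fun y ↦ by
    rw [← hM₂ y, add_comm, card_filter_add_card_filter_not, card_univ]
  have h₃ : ∀ x, #{y | ¬ N x y} + e = Fintype.card B := fun x ↦ by
    rw [← hN₁ x, add_comm, card_filter_add_card_filter_not, card_univ]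
  rintro (a | ⟨_ | _, x | x | x⟩) <;> rw [hdeg] <;>
  simp only [Fintype.sum_sum_type, Fintype.sum_prod_type, Fintype.sum_bool] <;>
  simp only [pentagonAdj, hN', ↓reduceIte, sum_boole, true_and, false_and, sum_const_zero, sum_const,
    smul_eq_mul, mul_one, card_univ, Nat.cast_id, ne_eq, not_true_eq_false, not_false_eq_true,
    reduceCtorEq]
  · omega
  · have := h₁ x; omega
  · have := h₂ x; have := h₃ x; omega
  · omega
  · have := h₁ x; omega
  · have := h₂ x; have := h₃ x; omega
  · omega

theorem card_filter_val_sub_lt {k u : ℕ} [NeZero k] (hu : u ≤ k) (x : Fin k) :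
    #{y : Fin k | (y - x).val < u} = u ∧ #{y : Fin k | (x - y).val < u} = u := by
  have h : #{z : Fin k | z.val < u} = u := by
    rw [Fin.card_filter_val_lt, min_eq_right hu]
  constructor
  · refine (card_equiv (Equiv.subRight x) fun y ↦ ?_).trans h
    simp
  · refine (card_equiv (Equiv.subLeft x) fun y ↦ ?_).trans h
    simp

theorem mul_le_rex_K3_of_le {n k e u : ℕ} (hu : u ≤ k) (he : e ≤ 1) (hk : 0 < k)
    (hn : n + e = 5 * k + 2 * (u + e)) : k * n ≤ rex n K3 := by
  classical
  have : NeZero k := ⟨hk.ne'⟩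
  refine le_rex (V := Fin (k - e) ⊕ (Bool × (Fin k ⊕ (Fin k ⊕ Fin (u + e))))) (d := 2 * k) ?_
    (pentagonGraph (Fin (k - e)) (Fin (u + e)) (fun x y : Fin k ↦ (y - x).val < u)
      fun x y ↦ e = 1 ∧ x = y) (K3_free_pentagonGraph _ _) ?_ (by ring)
  · simp
    omega
  · have := pentagonGraph_isRegularOfDegree (A := Fin (k - e)) (C := Fin (u + e))
      (M := fun x y : Fin k ↦ (y - x).val < u) (N := fun x y ↦ e = 1 ∧ x = y) (u := u) (e := e)
      (by rintro x y ⟨h, rfl⟩; exact ⟨h, rfl⟩)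
      (fun x ↦ by convert (card_filter_val_sub_lt hu x).1)
      (fun x ↦ by convert (card_filter_val_sub_lt hu x).2)
      (fun x ↦ by interval_cases e <;> simp [Finset.filter_eq]) (by simp; omega) (by simp)
    simpa using this

theorem nine_le_rex_nine : 9 ≤ rex 9 K3 := by
  classical
  refine le_rex (V := Fin 9) (d := 2) (by simp) (cycleGraph 9) ?_ ?_ (by norm_num)
  · rw [K3_free_iff]
    have : ∀ a b c : Fin 9, (cycleGraph 9).Adj a b → (cycleGraph 9).Adj a c →
        ¬ (cycleGraph 9).Adj b c := by
      simp only [cycleGraph_adj]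
      decide
    intro s hs
    obtain ⟨a, b, c, h1, h2, h3, -⟩ := is3Clique_iff.1 hs
    exact this a b c h1 h2 h3
  · intro v
    rw [← cycleGraph_degree_three_le (n := 6) (v := v)]
    congr!

theorem mul_le_rex_K3 {n k s : ℕ} (hn : n = 5 * k + s) (hs : s < 5) (hodd : Odd n) :
    k * n ≤ rex n K3 := by
  obtain rfl | hk := k.eq_zero_or_pos
  · simp
  obtain ⟨m, hm⟩ := hodd
  -- Here `e` is the parity of `s`; the construction needs `u = ⌊s/2⌋ ≤ k`, which fails only for `n
  -- = 9`, where the 9-cycle is used.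
  by_cases h9 : k = 1 ∧ s = 4
  · obtain ⟨rfl, rfl⟩ := h9
    subst hn
    exact nine_le_rex_nine
  · obtain ⟨j, hj⟩ := Nat.even_or_odd' k
    obtain hj | hj := hj
    · exact mul_le_rex_K3_of_le (e := 1) (u := (s - 1) / 2) (by omega) le_rfl hk (by omega)
    · exact mul_le_rex_K3_of_le (e := 0) (u := s / 2) (by omega) zero_le_one hk (by omega)

theorem rex_K3_of_odd {n k s : ℕ} (hn : n = 5 * k + s) (hs : s < 5) (hodd : Odd n) :
    rex n K3 = k * n ∧ rex n K3 = n * (n / 5) := by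
  have hk : n / 5 = k := by omega
  have h1 := mul_le_rex_K3 hn hs hodd
  have h2 := rex_le_mul_div_five hodd (F := K3) fun _ _ _ _ h ↦ h
  rw [hk, mul_comm n k] at *
  omega

end RegTuran

theorem theorem2 {W : Type*} [Finite W] (F : SimpleGraph W) (hF : F.chromaticNumber = 3) :
    -- (i) even `n`
    (((fun n : ℕ ↦ (RegTuran.rex n F : ℝ)) ~[atTop ⊓ 𝓟 {n : ℕ | Even n}]
        (fun n : ℕ ↦ (SimpleGraph.extremalNumber n F : ℝ))) ∧
      ((fun n : ℕ ↦ (RegTuran.rex n F : ℝ) - (n : ℝ) ^ 2 / 4)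
        =o[atTop ⊓ 𝓟 {n : ℕ | Even n}] (fun n : ℕ ↦ (n : ℝ) ^ 2)) ∧
      (∀ n : ℕ, Even n →
        (RegTuran.rex n RegTuran.K3 : ℝ) = (n : ℝ) ^ 2 / 4 ∧
        (RegTuran.rex n RegTuran.K4e : ℝ) = (n : ℝ) ^ 2 / 4)) ∧
    -- (ii) odd `n`, special `F`
    ((Nonempty (F ≃g RegTuran.K3) ∨ Nonempty (F ≃g RegTuran.K4e) ∨
        RegTuran.IsUnicyclicWithCycle F 3) →
      (∃ C : ℝ, ∀ n : ℕ, Odd n → (n : ℝ) ^ 2 / 5 - C * n ≤ (RegTuran.rex n F : ℝ)) ∧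
      (∃ N : ℕ, ∀ n : ℕ, N ≤ n → Odd n → (RegTuran.rex n F : ℝ) ≤ (n : ℝ) ^ 2 / 5)) ∧
    -- (iii) the exact value for the triangle and odd `n`
    (∀ n k s : ℕ, n = 5 * k + s → s < 5 → Odd n →
      RegTuran.rex n RegTuran.K3 = k * n ∧ RegTuran.rex n RegTuran.K3 = n * (n / 5)) := by
  have h3 : F.Colorable 3 := SimpleGraph.chromaticNumber_le_iff_colorable.1 hF.le
  have h2 : ¬ F.Colorable 2 := fun h ↦ by
    have := SimpleGraph.chromaticNumber_le_iff_colorable.2 h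
    rw [hF] at this
    exact absurd this (by decide)
  refine ⟨⟨RegTuran.rex_isEquivalent_extremalNumber h3 h2, RegTuran.rex_sub_isLittleO h3 h2, ?_⟩,
    -- `C = 1` suffices because `n⌊n/5⌋ ≥ n(n - 5)/5`.
    fun hS ↦ ⟨⟨1, fun n hn ↦ ?_⟩, ?_⟩, fun n k s hn hs hodd ↦ RegTuran.rex_K3_of_odd hn hs hodd⟩
  · rintro n ⟨m, rfl⟩
    obtain ⟨hK3, hK4⟩ := RegTuran.rex_add_self_eq (m := m)
    rw [hK3, hK4]
    push_cast
    constructor <;> ring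
  · have h := RegTuran.mul_le_rex_K3 (Nat.div_add_mod n 5).symm (Nat.mod_lt n (by norm_num)) hn
    have h' : (((n / 5) * n : ℕ) : ℝ) ≤ RegTuran.rex n F := by
      exact_mod_cast h.trans (RegTuran.rex_mono (RegTuran.K3_isContained_of_special hS))
    have hlt : (n : ℝ) ≤ 5 * (n / 5 : ℕ) + 5 := by
      exact_mod_cast (by omega : n ≤ 5 * (n / 5) + 5)
    push_cast at h'
    nlinarith [(Nat.cast_nonneg n : (0 : ℝ) ≤ n)]
  · obtain ⟨N, hN⟩ := RegTuran.exists_rex_le_mul_div_five hS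
    refine ⟨N, fun n hn hodd ↦ ?_⟩
    have h : (RegTuran.rex n F : ℝ) ≤ n * (n / 5 : ℕ) := by exact_mod_cast hN n hn hodd
    have h' : (n : ℝ) * (n / 5 : ℕ) ≤ n * (n / 5) := by gcongr; exact Nat.cast_div_le
    linarith
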